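/- For a probability measure $\mu$ on the Borel sets of $[0,\infty)$ and $c\in[0,1]$ (with $\log x$ semi-integrable with respect to $\mu$ if $c=1$), the Halász–Székely barycenter of $\mu$ is $$[\mu]_c := \exp \inf_{y>0} \int K(x,y,c)\,d\mu(x)\in[0,+\infty],$$ where $K(x,y,c)=\log y + c^{-1}\log\left(c y^{-1}x+1-c\right)$ if $c>0$ and $K(x,y,0)=\log y+y^{-1}x-1$ (with $\log 0=-\infty$ and $\exp(-\infty)=0$). For a tuple $\underline{x}=(x_1,\dots,x_n)$ of nonnegative real numbers let $$\mathsf{hsm}_c(\underline{x}) := \left[\frac{\delta_{x_1}+\dots+\delta_{x_n}}{n}\right]_c,\qquad \mathsf{sym}_k(\underline{x}) := \left(\frac{E_k(\underline{x})}{\binom{n}{k}}\right)^{1/k}\quad(1\le k\le n),$$ where $E_k$ is the elementary symmetric polynomial of degree $k$ in $n$ variables, and let $\underline{x}^{(m)}$ be the $nm$-tuple obtained by concatenating $m$ copies of $\underline{x}$. **Theorem.** Let $1\le k\le n$ be integers. For every $\underline{x}=(x_1,\dots,x_n)$ with all $x_i\ge 0$, $\mathsf{hsm}_{k/n}(\underline{x})$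 is finite and $$\lim_{m\to\infty}\mathsf{sym}_{km}\left(\underline{x}^{(m)}\right)=\mathsf{hsm}_{k/n}(\underline{x}).$$ Furthermore, the relative error goes to zero uniformly with respect to the $x_i$'s: for every $\varepsilon>0$ there is $M$ such that for all $m\ge M$ and all $\underline{x}\in[0,\infty)^n$, $$\left|\mathsf{sym}_{km}\left(\underline{x}^{(m)}\right)-\mathsf{hsm}_{k/n}(\underline{x})\right|\le\varepsilon\,\mathsf{hsm}_{k/n}(\underline{x}).$$ Explicitly, for every $m\ge1$ and every $\underline{x}\in[0,\infty)^n$, $$\mathsf{hsm}_{k/n}(\underline{x})\le\mathsf{sym}_{km}\left(\underline{x}^{(m)}\right)\le(9km)^{\frac{1}{2km}}\,\mathsf{hsm}_{k/n}(\underline{x}).$$ -/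

import Mathlib

open Filter Topology MeasureTheory
open scoped NNReal ENNReal

noncomputable section

/-- The `k`-th symmetric mean `(E_k(x) / binom(n, k)) ^ (1 / k)` of an `n`-tuple of
nonnegative numbers, where `E_k` is the elementary symmetric polynomial of degree `k`. -/
def symMean {n : ℕ} (k : ℕ) (x : Fin n → ℝ≥0) : ℝ≥0 :=
  (MvPolynomial.eval x (MvPolynomial.esymm (Fin n) ℝ≥0 k) / (n.choose k : ℝ≥0)) ^ (1 / (k : ℝ))

/-- The integral of an extended-real-valued function, `∫ f⁺ - ∫ f⁻` in `[-∞, +∞]`. It is the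
usual integral of a measurable function that is semi-integrable (`∫ f⁺` or `∫ f⁻` is finite). -/
def extIntegral {α : Type*} [MeasurableSpace α] (μ : Measure α) (f : α → EReal) : EReal :=
  ((∫⁻ a, (f a).toENNReal ∂μ : ℝ≥0∞) : EReal) - ((∫⁻ a, (-f a).toENNReal ∂μ : ℝ≥0∞) : EReal)

/-- The Halász–Székely kernel `K(x, y, c)`, for `x ≥ 0`, `y > 0`, `0 ≤ c ≤ 1`, with values in
`[-∞, +∞)`. Here `ENNReal.log` is the logarithm with `log 0 = -∞`; its argument
`c y⁻¹ x + 1 - c` is nonnegative for these parameters. -/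
def hsKernel (x : ℝ≥0) (y c : ℝ) : EReal :=
  if c = 0 then
    ((Real.log y + y⁻¹ * (x : ℝ) - 1 : ℝ) : EReal)
  else
    ((Real.log y : ℝ) : EReal) +
      ((c⁻¹ : ℝ) : EReal) * ENNReal.log (ENNReal.ofReal (c * y⁻¹ * (x : ℝ) + 1 - c))

/-- The Halász–Székely barycenter `exp (inf_{y > 0} ∫ K(x, y, c) dμ(x))`, in `[0, +∞]`, of a
Borel probability measure `μ` on `[0, ∞)` with parameter `c ∈ [0, 1]`. -/
def hsBarycenter (μ : Measure ℝ≥0) (c : ℝ) : ℝ≥0∞ :=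
  EReal.exp (⨅ (y : ℝ) (_ : 0 < y), extIntegral μ (fun x => hsKernel x y c))

/-- The measure `(δ_{x_1} + ⋯ + δ_{x_n}) / n` on `[0, ∞)`. -/
def tupleMeasure {n : ℕ} (x : Fin n → ℝ≥0) : Measure ℝ≥0 :=
  (n : ℝ≥0∞)⁻¹ • ∑ i, Measure.dirac (x i)

/-- The Halász–Székely mean of a tuple of nonnegative numbers with parameter `c ∈ [0, 1]`. -/
def hsMean {n : ℕ} (c : ℝ) (x : Fin n → ℝ≥0) : ℝ≥0∞ :=
  hsBarycenter (tupleMeasure x) c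

end

/-!
For a tuple of nonnegative numbers `x_1, …, x_n` and `c = k / n`, the `k`-th power of the
Halász–Székely mean is the infimum over `y > 0` of `hsProd = y ^ k * ∏ (c x_i / y + 1 - c)`.
With `q_j = E_j / binom(n, j)` the binomial expansion reads
`hsProd = ∑ j, binom(n, j) c ^ j (1 - c) ^ (n - j) * q_j y ^ (k - j)`, and `q_k` is the `k`-th power
of the symmetric mean. Both means are compared through this formula.

* All terms are nonnegative, so `hsProd` is at least its term with `j = k`, which is `q_k` times the
  probability of `k` under the binomial law of parameters `n`, `c`. That probability is at least the
  probability of `k` under the Poisson law of parameter `k`, which is at least `1 / √(9 k)` by a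
  Stirling bound (`one_le_sqrt_mul_choose_mul`).
* By Newton's inequality (`avgEsymm_mul_le_sq`) the sequence `q_j` is log-concave. If `q_k > 0` and
  `y = q_k / q_(k-1)`, then `q_j y ^ (k - j) ≤ q_k` for every `j`, so that `hsProd` at `y` is a
  weighted mean of numbers at most `q_k`. If `q_k = 0`, then `hsProd` tends to `0` as `y → 0`. In
  both cases the infimum is at most `q_k` (`le_avgEsymm_of_forall_le_hsProd`).

Repeating a tuple changes neither its uniform measure nor the parameter `k / n`, so the two bounds
for the pair `(k m, n m)` are the explicit estimate. Since `(9 k m) ^ (1 / (2 k m))` tends to `1`,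
the estimate gives the limit and the uniform bound of the relative error.
-/

/-! ### Normalized elementary symmetric polynomials -/

/-- The average `E_j / binom(card s, j)` of the products of `j` entries of `s`. It is `0`
for `j > card s`. -/
noncomputable def avgEsymm (s : Multiset ℝ) (j : ℕ) : ℝ := s.esymm j / (s.card.choose j : ℝ)

theorem esymm_cons (a : ℝ) (s : Multiset ℝ) (j : ℕ) :
    (a ::ₘ s).esymm (j + 1) = s.esymm (j + 1) + a * s.esymm j := by
  simp [Multiset.esymm, Multiset.powersetCard_cons, Multiset.map_map,
    Multiset.sum_map_mul_left]

theorem esymm_eq_zero_of_card_lt {s : Multiset ℝ} {j : ℕ} (h : s.card < j) : s.esymm j = 0 := by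
  simp [Multiset.esymm, Multiset.powersetCard_eq_empty _ h]

theorem avgEsymm_zero (s : Multiset ℝ) : avgEsymm s 0 = 1 := by
  simp [avgEsymm, Multiset.esymm]

theorem avgEsymm_eq_zero_of_card_lt {s : Multiset ℝ} {j : ℕ} (h : s.card < j) :
    avgEsymm s j = 0 := by
  simp [avgEsymm, esymm_eq_zero_of_card_lt h]

theorem esymm_nonneg {s : Multiset ℝ} (hs : ∀ x ∈ s, 0 ≤ x) (j : ℕ) : 0 ≤ s.esymm j := by
  refine Multiset.sum_nonneg fun p hp => ?_
  obtain ⟨t, ht, rfl⟩ := Multiset.mem_map.1 hp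
  exact Multiset.prod_nonneg fun x hx =>
    hs x (Multiset.mem_of_le (Multiset.mem_powersetCard.1 ht).1 hx)

theorem avgEsymm_nonneg {s : Multiset ℝ} (hs : ∀ x ∈ s, 0 ≤ x) (j : ℕ) : 0 ≤ avgEsymm s j :=
  div_nonneg (esymm_nonneg hs j) (Nat.cast_nonneg _)

theorem esymm_eq_choose_mul_avgEsymm (s : Multiset ℝ) (j : ℕ) :
    s.esymm j = (s.card.choose j : ℝ) * avgEsymm s j := by
  rcases lt_or_ge s.card j with h | h
  · simp [avgEsymm_eq_zero_of_card_lt h, esymm_eq_zero_of_card_lt h]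
  · have : (s.card.choose j : ℝ) ≠ 0 := by exact_mod_cast (Nat.choose_pos h).ne'
    rw [avgEsymm, mul_div_cancel₀ _ this]

theorem avgEsymm_cons (a : ℝ) (s : Multiset ℝ) (j : ℕ) :
    ((s.card : ℝ) + 1) * avgEsymm (a ::ₘ s) (j + 1) =
      ((s.card : ℝ) - j) * avgEsymm s (j + 1) + ((j : ℝ) + 1) * a * avgEsymm s j := by
  set n := s.card with hn
  rcases lt_or_ge n j with h | h
  · rw [avgEsymm_eq_zero_of_card_lt (show (a ::ₘ s).card < j + 1 by simp; lia),
      avgEsymm_eq_zero_of_card_lt (show s.card < j + 1 by lia),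
      avgEsymm_eq_zero_of_card_lt (show s.card < j by lia)]
    simp
  · have hC : (n.choose j : ℝ) ≠ 0 := by exact_mod_cast (Nat.choose_pos h).ne'
    have hC' : ((n + 1).choose (j + 1) : ℝ) ≠ 0 := by
      exact_mod_cast (Nat.choose_pos (by lia : j + 1 ≤ n + 1)).ne'
    have h1 : ((n : ℝ) + 1) * n.choose j = (n + 1).choose (j + 1) * ((j : ℝ) + 1) := by
      exact_mod_cast Nat.add_one_mul_choose_eq n j
    have h2 : (n.choose (j + 1) : ℝ) * ((j : ℝ) + 1) = n.choose j * ((n : ℝ) - j) := by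
      have := Nat.choose_succ_right_eq n j
      rw [← Nat.cast_sub h]
      exact_mod_cast this
    have h3 : ((n : ℝ) - j) * avgEsymm s (j + 1) = (j + 1) * s.esymm (j + 1) / n.choose j := by
      rw [esymm_eq_choose_mul_avgEsymm s (j + 1), ← hn, eq_div_iff hC]
      linear_combination (-avgEsymm s (j + 1)) * h2
    rw [h3]
    simp only [avgEsymm, esymm_cons, Multiset.card_cons, ← hn]
    field_simp
    linear_combination (s.esymm (j + 1) + a * s.esymm j) * h1

/-- The averages have no internal zeros. -/
theorem avgEsymm_succ_eq_zero {s : Multiset ℝ} (hs : ∀ x ∈ s, 0 ≤ x) :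
    ∀ j, avgEsymm s j = 0 → avgEsymm s (j + 1) = 0 := by
  induction s using Multiset.induction with
  | empty => exact fun j _ => avgEsymm_eq_zero_of_card_lt (by simp)
  | cons a s ih =>
    have ha : 0 ≤ a := hs a (Multiset.mem_cons_self a s)
    have hs' : ∀ x ∈ s, 0 ≤ x := fun x hx => hs x (Multiset.mem_cons_of_mem hx)
    rintro (_ | i) h
    · simp [avgEsymm_zero] at h
    rcases lt_or_ge s.card (i + 1) with hc | hc
    · exact avgEsymm_eq_zero_of_card_lt (by simp; lia)
    have h1 := avgEsymm_cons a s i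
    have h2 := avgEsymm_cons a s (i + 1)
    rw [h, mul_zero] at h1
    have hc' : (i : ℝ) + 1 ≤ s.card := by exact_mod_cast hc
    have p1 := avgEsymm_nonneg hs' (i + 1)
    have p0 : 0 ≤ ((i : ℝ) + 1) * a * avgEsymm s i := by
      have := avgEsymm_nonneg hs' i
      positivity
    have h3 : avgEsymm s (i + 1) = 0 := by nlinarith
    rw [h3, ih hs' _ h3] at h2
    have : (s.card : ℝ) + 1 ≠ 0 := by positivity
    simpa [this] using h2

/-- A log-concave sequence without internal zeros has nonincreasing ratios `q (i + 1) / q i`. -/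
theorem mul_succ_le_succ_mul {q : ℕ → ℝ} (h0 : ∀ j, 0 ≤ q j)
    (hz : ∀ j, q j = 0 → q (j + 1) = 0) (hq : ∀ j, q j * q (j + 2) ≤ q (j + 1) ^ 2)
    {i j : ℕ} (hij : i ≤ j) : q i * q (j + 1) ≤ q (i + 1) * q j := by
  induction j, hij using Nat.le_induction with
  | base => exact (mul_comm _ _).le
  | succ j _ ih =>
    rcases (h0 j).eq_or_lt with h | h
    · have h1 := hz _ h.symm
      simp [h1, hz _ h1]
    · refine le_of_mul_le_mul_right ?_ h
      calc q i * q (j + 2) * q j = q i * (q j * q (j + 2)) := by ring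
        _ ≤ q i * q (j + 1) ^ 2 := mul_le_mul_of_nonneg_left (hq j) (h0 i)
        _ = q i * q (j + 1) * q (j + 1) := by ring
        _ ≤ q (i + 1) * q j * q (j + 1) := mul_le_mul_of_nonneg_right ih (h0 _)
        _ = q (i + 1) * q (j + 1) * q j := by ring

/-- The inequality that carries Newton's inequality over to a multiset with one more entry `a`. -/
theorem newton_step {u v a p₀ p₁ p₂ p₃ : ℝ} (hu : 1 ≤ u) (hv : 1 ≤ v) (ha : 0 ≤ a)
    (h1 : p₁ * p₃ ≤ p₂ ^ 2) (h2 : p₀ * p₂ ≤ p₁ ^ 2) (h3 : p₀ * p₃ ≤ p₁ * p₂) :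
    ((u + 1) * p₁ + (v - 1) * a * p₀) * ((u - 1) * p₃ + (v + 1) * a * p₂) ≤
      (u * p₂ + v * a * p₁) ^ 2 := by
  have e1 : 0 ≤ (u ^ 2 - 1) * (p₂ ^ 2 - p₁ * p₃) :=
    mul_nonneg (by nlinarith) (sub_nonneg.2 h1)
  have e2 : 0 ≤ a ^ 2 * (v ^ 2 - 1) * (p₁ ^ 2 - p₀ * p₂) :=
    mul_nonneg (mul_nonneg (sq_nonneg a) (by nlinarith)) (sub_nonneg.2 h2)
  have e3 : 0 ≤ a * ((u - 1) * (v - 1)) * (p₁ * p₂ - p₀ * p₃) :=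
    mul_nonneg (mul_nonneg ha (mul_nonneg (by linarith) (by linarith))) (sub_nonneg.2 h3)
  have e4 := sq_nonneg (p₂ - a * p₁)
  linear_combination e1 + e2 + e3 + e4

/-- **Newton's inequality** for nonnegative reals. -/
theorem avgEsymm_mul_le_sq {s : Multiset ℝ} (hs : ∀ x ∈ s, 0 ≤ x) :
    ∀ j, avgEsymm s j * avgEsymm s (j + 2) ≤ avgEsymm s (j + 1) ^ 2 := by
  induction s using Multiset.induction with
  | empty =>
    intro j
    rw [avgEsymm_eq_zero_of_card_lt (show (0 : Multiset ℝ).card < j + 2 by simp), mul_zero]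
    positivity
  | cons a s ih =>
    intro j
    have ha : 0 ≤ a := hs a (Multiset.mem_cons_self a s)
    have hs' : ∀ x ∈ s, 0 ≤ x := fun x hx => hs x (Multiset.mem_cons_of_mem hx)
    specialize ih hs'
    have h0 := avgEsymm_nonneg hs'
    rcases lt_or_ge s.card (j + 1) with hc | hc
    · rw [avgEsymm_eq_zero_of_card_lt (show (a ::ₘ s).card < j + 2 by simp; lia), mul_zero]
      positivity
    have hc' : (j : ℝ) + 1 ≤ s.card := by exact_mod_cast hc
    have hpos : (0 : ℝ) < ((s.card : ℝ) + 1) ^ 2 := by positivity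
    refine le_of_mul_le_mul_left ?_ hpos
    have r1 := avgEsymm_cons a s j
    have r2 := avgEsymm_cons a s (j + 1)
    have key : (((s.card : ℝ) + 1) * avgEsymm (a ::ₘ s) j) *
        (((s.card : ℝ) + 1) * avgEsymm (a ::ₘ s) (j + 1 + 1)) ≤
        (((s.card : ℝ) + 1) * avgEsymm (a ::ₘ s) (j + 1)) ^ 2 := by
      rw [r1, r2]
      rcases j with _ | i
      · -- there is no average of index `-1`; `newton_step` is used with `0` in its place
        have h := newton_step (u := (s.card : ℝ)) (v := 1) (p₀ := 0) (by simpa using hc') le_rfl ha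
          (ih 0) (by simpa using sq_nonneg _) (by simpa using mul_nonneg (h0 0) (h0 1))
        simp only [avgEsymm_zero] at h ⊢
        norm_num at h ⊢
        linarith
      · rw [avgEsymm_cons a s i]
        push_cast at hc' ⊢
        have hi : (0 : ℝ) ≤ i := Nat.cast_nonneg i
        have h := newton_step (u := (s.card : ℝ) - i - 1) (v := (i : ℝ) + 2) (by linarith)
          (by linarith) ha (ih (i + 1)) (ih i)
          (mul_succ_le_succ_mul h0 (avgEsymm_succ_eq_zero hs') ih (Nat.le_add_right i 2))
        convert h using 2 <;> ring_nf
    linear_combination key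

/-! ### The function minimized by the Halász–Székely mean -/

/-- The function `y ^ k * ∏ (c x / y + 1 - c)` of `y`. For `c = k / card s` it is the `k`-th power
of `exp ∫ K(x, y, c) dμ(x)`, where `μ` is the uniform measure on the entries of `s`. -/
noncomputable def hsProd (s : Multiset ℝ) (k : ℕ) (c y : ℝ) : ℝ :=
  y ^ k * (s.map fun x => c * y⁻¹ * x + 1 - c).prod

theorem hsProd_nonneg {s : Multiset ℝ} (hs : ∀ x ∈ s, 0 ≤ x) (k : ℕ) {c y : ℝ} (hc0 : 0 ≤ c)
    (hc1 : c ≤ 1) (hy : 0 < y) : 0 ≤ hsProd s k c y := by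
  refine mul_nonneg (by positivity) (Multiset.prod_nonneg fun z hz => ?_)
  obtain ⟨x, hx, rfl⟩ := Multiset.mem_map.1 hz
  have := mul_nonneg (mul_nonneg hc0 (inv_nonneg.2 hy.le)) (hs x hx)
  linarith

theorem prod_map_mul_add (s : Multiset ℝ) (a b : ℝ) :
    (s.map fun x => a * x + b).prod =
      ∑ j ∈ Finset.range (s.card + 1), s.esymm j * a ^ j * b ^ (s.card - j) := by
  have h := congrArg (Polynomial.eval b) (Multiset.prod_X_add_C_eq_sum_esymm (s.map (a • ·)))
  rw [Polynomial.eval_multiset_prod, Polynomial.eval_finsetSum] at h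
  simp only [Multiset.map_map, Multiset.card_map, Function.comp_def, Polynomial.eval_add,
    Polynomial.eval_X, Polynomial.eval_C, Polynomial.eval_mul, Polynomial.eval_pow,
    smul_eq_mul] at h
  refine Eq.trans (by simp only [add_comm b]) (h.trans (Finset.sum_congr rfl fun j _ => ?_))
  have hj := (Multiset.pow_smul_esymm a j s).symm
  simp only [smul_eq_mul] at hj
  rw [hj, mul_comm (a ^ j)]

theorem hsProd_eq_sum (s : Multiset ℝ) (k : ℕ) (c y : ℝ) :
    hsProd s k c y = ∑ j ∈ Finset.range (s.card + 1),
      (s.card.choose j * c ^ j * (1 - c) ^ (s.card - j)) *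
        (avgEsymm s j * (y ^ k * (y⁻¹) ^ j)) := by
  simp only [hsProd, add_sub_assoc, prod_map_mul_add, Finset.mul_sum]
  refine Finset.sum_congr rfl fun j _ => ?_
  rw [esymm_eq_choose_mul_avgEsymm, mul_pow]
  ring

/-- Every value of `hsProd` bounds a single term of its binomial expansion. -/
theorem choose_mul_avgEsymm_le_hsProd {s : Multiset ℝ} (hs : ∀ x ∈ s, 0 ≤ x) {k : ℕ}
    (hk : k ≤ s.card) {c y : ℝ} (hc0 : 0 ≤ c) (hc1 : c ≤ 1) (hy : 0 < y) :
    (s.card.choose k * c ^ k * (1 - c) ^ (s.card - k)) * avgEsymm s k ≤ hsProd s k c y := by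
  have hc : 0 ≤ 1 - c := sub_nonneg.2 hc1
  rw [hsProd_eq_sum]
  refine le_of_eq_of_le ?_ (Finset.single_le_sum (fun j _ => ?_)
    (Finset.mem_range.2 (Nat.lt_succ_of_le hk)))
  · rw [← mul_pow, mul_inv_cancel₀ hy.ne', one_pow, mul_one]
  · have := avgEsymm_nonneg hs j
    positivity

/-- A sequence with nonincreasing ratios lies below the geometric sequence that agrees with it
at `k` and `k + 1`. -/
theorem mul_ratio_pow_le {q : ℕ → ℝ} (h0 : ∀ j, 0 ≤ q j)
    (hq : ∀ i j, i ≤ j → q i * q (j + 1) ≤ q (i + 1) * q j) {l : ℕ} (hl : 0 < q l) (j : ℕ) :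
    q j * (q (l + 1) / q l) ^ (l + 1) ≤ q (l + 1) * (q (l + 1) / q l) ^ j := by
  set r := q (l + 1) / q l with hr
  have hr0 : 0 ≤ r := div_nonneg (h0 _) hl.le
  have up : ∀ i, q (l + 1 + i) ≤ q (l + 1) * r ^ i := by
    intro i
    induction i with
    | zero => simp
    | succ i ih =>
      have h := hq l (l + 1 + i) (by lia)
      have : q (l + 1 + i + 1) ≤ r * q (l + 1 + i) := by
        rw [hr, div_mul_eq_mul_div, le_div_iff₀ hl, mul_comm]
        exact h
      calc q (l + 1 + (i + 1)) ≤ r * q (l + 1 + i) := this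
        _ ≤ r * (q (l + 1) * r ^ i) := mul_le_mul_of_nonneg_left ih hr0
        _ = _ := by ring
  have down : ∀ i, i ≤ l + 1 → q (l + 1 - i) * r ^ i ≤ q (l + 1) := by
    intro i
    induction i with
    | zero => simp
    | succ i ih =>
      intro hi
      have h := hq (l - i) l (by lia)
      have e : l + 1 - i = l - i + 1 := by lia
      have : q (l - i) * r ≤ q (l - i + 1) := by
        rw [hr, ← mul_div_assoc, div_le_iff₀ hl]
        exact h
      calc q (l + 1 - (i + 1)) * r ^ (i + 1) = q (l - i) * r * r ^ i := by
            rw [Nat.add_sub_add_right]; ring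
        _ ≤ q (l - i + 1) * r ^ i := mul_le_mul_of_nonneg_right this (by positivity)
        _ ≤ q (l + 1) := e ▸ ih (by lia)
  rcases le_total (l + 1) j with h | h
  · obtain ⟨i, rfl⟩ := Nat.exists_eq_add_of_le h
    calc q (l + 1 + i) * r ^ (l + 1) ≤ q (l + 1) * r ^ i * r ^ (l + 1) :=
          mul_le_mul_of_nonneg_right (up i) (by positivity)
      _ = _ := by ring
  · obtain ⟨i, hi⟩ := Nat.exists_eq_add_of_le h
    have hd := down i (by lia)
    rw [show l + 1 - i = j by lia] at hd
    calc q j * r ^ (l + 1) = q j * r ^ i * r ^ j := by rw [hi]; ring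
      _ ≤ q (l + 1) * r ^ j := mul_le_mul_of_nonneg_right hd (by positivity)

theorem sum_choose_mul_pow_mul_pow (n : ℕ) (c : ℝ) :
    ∑ j ∈ Finset.range (n + 1), (n.choose j * c ^ j * (1 - c) ^ (n - j)) = 1 := by
  have h := add_pow c (1 - c) n
  rw [add_sub_cancel, one_pow] at h
  exact (Finset.sum_congr rfl fun j _ => by ring).trans h.symm

/-- When the `k`-th average is positive, the value of `hsProd` at the ratio of the `k`-th and the
`(k - 1)`-th average is a binomial mean of quantities that are at most the `k`-th average. -/
theorem exists_hsProd_le_avgEsymm {s : Multiset ℝ} (hs : ∀ x ∈ s, 0 ≤ x) {l : ℕ}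
    (hpos : 0 < avgEsymm s (l + 1)) {c : ℝ} (hc0 : 0 ≤ c) (hc1 : c ≤ 1) :
    ∃ y, 0 < y ∧ hsProd s (l + 1) c y ≤ avgEsymm s (l + 1) := by
  have hc : 0 ≤ 1 - c := sub_nonneg.2 hc1
  have hl : 0 < avgEsymm s l := (avgEsymm_nonneg hs l).lt_of_ne fun h =>
    hpos.ne' (avgEsymm_succ_eq_zero hs l h.symm)
  have hr := div_pos hpos hl
  refine ⟨_, hr, ?_⟩
  rw [hsProd_eq_sum]
  refine le_of_le_of_eq ?_ ((Finset.sum_mul _ _ _).symm.trans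
    (by rw [sum_choose_mul_pow_mul_pow s.card c, one_mul] :
      _ * avgEsymm s (l + 1) = avgEsymm s (l + 1)))
  refine Finset.sum_le_sum fun j _ => mul_le_mul_of_nonneg_left ?_
    (mul_nonneg (by positivity) (pow_nonneg hc _))
  have h := mul_ratio_pow_le (avgEsymm_nonneg hs) (fun i j hij => mul_succ_le_succ_mul
    (avgEsymm_nonneg hs) (avgEsymm_succ_eq_zero hs) (avgEsymm_mul_le_sq hs) hij) hl j
  rw [← mul_assoc, inv_pow, ← div_eq_mul_inv, div_le_iff₀ (by positivity)]
  exact h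

/-- When the `k`-th average vanishes, `hsProd` is a polynomial in `y` without constant term. -/
theorem tendsto_hsProd_zero {s : Multiset ℝ} (hs : ∀ x ∈ s, 0 ≤ x) {k : ℕ}
    (hz : avgEsymm s k = 0) (c : ℝ) : Tendsto (hsProd s k c) (𝓝[>] 0) (𝓝 0) := by
  have hz' : ∀ j, k ≤ j → avgEsymm s j = 0 := fun j hj => by
    induction j, hj using Nat.le_induction with
    | base => exact hz
    | succ j _ ih => exact avgEsymm_succ_eq_zero hs j ih
  have h1 : Tendsto (fun y : ℝ => ∑ j ∈ Finset.range (s.card + 1),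
      (s.card.choose j * c ^ j * (1 - c) ^ (s.card - j)) * (avgEsymm s j * y ^ (k - j)))
      (𝓝[>] 0) (𝓝 0) := by
    have hcont : Continuous fun y : ℝ => ∑ j ∈ Finset.range (s.card + 1),
      (s.card.choose j * c ^ j * (1 - c) ^ (s.card - j)) * (avgEsymm s j * y ^ (k - j)) := by
      fun_prop
    have h := (hcont.tendsto 0).mono_left (nhdsWithin_le_nhds (s := Set.Ioi 0))
    convert h using 2
    refine (Finset.sum_eq_zero fun j _ => ?_).symm
    rcases le_or_gt k j with hj | hj
    · simp [hz' j hj]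
    · simp [Nat.sub_ne_zero_of_lt hj]
  refine h1.congr' (eventually_nhdsWithin_of_forall fun y (hy : 0 < y) => ?_)
  rw [hsProd_eq_sum]
  refine Finset.sum_congr rfl fun j _ => ?_
  rcases le_or_gt k j with hj | hj
  · simp [hz' j hj]
  · rw [pow_sub₀ _ hy.ne' hj.le, inv_pow]

/-- A lower bound of all values of `hsProd` is a lower bound of the `k`-th average. -/
theorem le_avgEsymm_of_forall_le_hsProd {s : Multiset ℝ} (hs : ∀ x ∈ s, 0 ≤ x) {k : ℕ}
    (hk : 1 ≤ k) {b c : ℝ} (hc0 : 0 ≤ c) (hc1 : c ≤ 1)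
    (hb : ∀ y, 0 < y → b ≤ hsProd s k c y) : b ≤ avgEsymm s k := by
  obtain ⟨l, rfl⟩ := Nat.exists_eq_add_of_le' hk
  rcases (avgEsymm_nonneg hs (l + 1)).eq_or_lt with h | h
  · rw [← h]
    exact ge_of_tendsto (tendsto_hsProd_zero hs h.symm c)
      (eventually_nhdsWithin_of_forall fun y hy => hb y hy)
  · obtain ⟨y, hy, hle⟩ := exists_hsProd_le_avgEsymm hs h hc0 hc1
    exact (hb y hy).trans hle

/-! ### The largest binomial probability -/

/-- `n! eⁿ / nⁿ` is nondecreasing in `n`. -/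
theorem monotone_factorial_mul_exp_div :
    Monotone fun n : ℕ => (n.factorial : ℝ) * Real.exp n / (n : ℝ) ^ n := by
  refine monotone_nat_of_le_succ fun n => ?_
  rcases Nat.eq_zero_or_pos n with rfl | hn
  · simp
  have hn' : (0 : ℝ) < n := by exact_mod_cast hn
  have h : ((n : ℝ) + 1) ^ n ≤ Real.exp 1 * (n : ℝ) ^ n := by
    have h1 : (1 / (n : ℝ) + 1) ^ n ≤ Real.exp (1 / n) ^ n :=
      pow_le_pow_left₀ (by positivity) (Real.add_one_le_exp _) n
    rw [← Real.exp_nat_mul, mul_one_div_cancel hn'.ne'] at h1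
    calc ((n : ℝ) + 1) ^ n = (1 / (n : ℝ) + 1) ^ n * (n : ℝ) ^ n := by
          rw [← mul_pow]; congr 1; field_simp; ring
      _ ≤ _ := mul_le_mul_of_nonneg_right h1 (by positivity)
  rw [div_le_div_iff₀ (by positivity) (by positivity)]
  push_cast [Nat.factorial_succ]
  rw [Real.exp_add, pow_succ]
  have := mul_le_mul_of_nonneg_left h
    (show 0 ≤ (n.factorial : ℝ) * Real.exp n * ((n : ℝ) + 1) by positivity)
  linear_combination this

/-- The bound `k! ≤ e √k (k / e) ^ k`, which says that `Stirling.stirlingSeq` is largest at `1`,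
with the factor `e` rounded up to `3`. -/
theorem factorial_le_three_mul_sqrt {k : ℕ} (hk : 1 ≤ k) :
    (k.factorial : ℝ) * Real.exp k ≤ 3 * √k * (k : ℝ) ^ k := by
  obtain ⟨l, rfl⟩ := Nat.exists_eq_add_of_le' hk
  have h := Stirling.stirlingSeq'_antitone (Nat.zero_le l)
  simp only [Function.comp, Nat.succ_eq_add_one, zero_add, Stirling.stirlingSeq_one] at h
  rw [Stirling.stirlingSeq] at h
  have hs2 : 0 < √(2 : ℝ) := by positivity
  rw [div_le_div_iff₀ (by positivity) hs2,
    Real.sqrt_mul (by norm_num), div_pow, ← Real.exp_nat_mul, mul_one] at h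
  have h2 : ((l + 1).factorial : ℝ) ≤
      Real.exp 1 * (√((l + 1 : ℕ) : ℝ) * (((l + 1 : ℕ) : ℝ) ^ (l + 1) / Real.exp (l + 1 : ℕ))) := by
    refine le_of_mul_le_mul_right ?_ hs2
    linear_combination h
  have he : Real.exp 1 ≤ 3 := by linarith [Real.exp_one_lt_d9]
  calc ((l + 1).factorial : ℝ) * Real.exp (l + 1 : ℕ)
      ≤ Real.exp 1 * (√((l + 1 : ℕ) : ℝ) * (((l + 1 : ℕ) : ℝ) ^ (l + 1) / Real.exp (l + 1 : ℕ))) *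
        Real.exp (l + 1 : ℕ) := mul_le_mul_of_nonneg_right h2 (Real.exp_pos _).le
    _ = Real.exp 1 * √((l + 1 : ℕ) : ℝ) * ((l + 1 : ℕ) : ℝ) ^ (l + 1) := by field_simp
    _ ≤ _ := by gcongr

/-- The probability of the value `k` under the binomial law of parameters `n`, `k / n` is at least
the probability of `k` under the Poisson law of parameter `k`, hence at least `1 / √(9 k)`. -/
theorem one_le_sqrt_mul_choose_mul {n k : ℕ} (hk : 1 ≤ k) (hkn : k ≤ n) :
    1 ≤ √(9 * k) * (n.choose k * ((k : ℝ) / n) ^ k * (1 - (k : ℝ) / n) ^ (n - k)) := by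
  have hk' : (0 : ℝ) < k := by exact_mod_cast hk
  have hn' : (0 : ℝ) < n := by exact_mod_cast hk.trans hkn
  have h1 := monotone_factorial_mul_exp_div (Nat.sub_le n k)
  have h2 := factorial_le_three_mul_sqrt hk
  have hD : (0 : ℝ) < ((n - k : ℕ) : ℝ) ^ (n - k) := by
    rcases Nat.eq_zero_or_pos (n - k) with h | h
    · simp [h]
    · exact pow_pos (by exact_mod_cast h) _
  have hch : (n.choose k : ℝ) * k.factorial * (n - k).factorial = n.factorial := by
    exact_mod_cast Nat.choose_mul_factorial_mul_factorial hkn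
  simp only at h1
  rw [div_le_div_iff₀ hD (by positivity), ← hch] at h1
  have hexp : Real.exp n = Real.exp k * Real.exp (n - k : ℕ) := by
    rw [← Real.exp_add, Nat.cast_sub hkn, add_sub_cancel]
  rw [hexp] at h1
  have h3 : (n : ℝ) ^ n ≤
      n.choose k * (k.factorial * Real.exp k) * ((n - k : ℕ) : ℝ) ^ (n - k) := by
    refine le_of_mul_le_mul_left ?_
      (show 0 < ((n - k).factorial : ℝ) * Real.exp (n - k : ℕ) by positivity)
    linear_combination h1
  have h4 : (n : ℝ) ^ n ≤ n.choose k * (3 * √k * (k : ℝ) ^ k) * ((n - k : ℕ) : ℝ) ^ (n - k) :=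
    h3.trans (by gcongr)
  have h9 : √(9 * (k : ℝ)) = 3 * √k := by
    rw [Real.sqrt_mul (by norm_num), show (9 : ℝ) = 3 ^ 2 by norm_num,
      Real.sqrt_sq (by norm_num)]
  have hsub : 1 - (k : ℝ) / n = ((n - k : ℕ) : ℝ) / n := by
    rw [Nat.cast_sub hkn, sub_div, div_self hn'.ne']
  have hpow : (n : ℝ) ^ n = (n : ℝ) ^ k * (n : ℝ) ^ (n - k) := by
    rw [← pow_add, Nat.add_sub_cancel' hkn]
  rw [h9, hsub, div_pow, div_pow]
  have : 3 * √k * (n.choose k * ((k : ℝ) ^ k / (n : ℝ) ^ k) *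
      (((n - k : ℕ) : ℝ) ^ (n - k) / (n : ℝ) ^ (n - k))) =
      n.choose k * (3 * √k * (k : ℝ) ^ k) * ((n - k : ℕ) : ℝ) ^ (n - k) / (n : ℝ) ^ n := by
    rw [hpow]; field_simp
  rw [this, one_le_div (by positivity)]
  exact h4

/-! ### The Halász–Székely mean as an infimum of real numbers -/

theorem lintegral_tupleMeasure {n : ℕ} (x : Fin n → ℝ≥0) (f : ℝ≥0 → ℝ≥0∞) :
    ∫⁻ a, f a ∂tupleMeasure x = (n : ℝ≥0∞)⁻¹ * ∑ i, f (x i) := by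
  simp [tupleMeasure, lintegral_smul_measure]

theorem lintegral_tupleMeasure_ofReal {n : ℕ} (hn : 0 < n) (x : Fin n → ℝ≥0) {f : ℝ≥0 → ℝ≥0∞}
    {g : Fin n → ℝ} (hfg : ∀ i, f (x i) = ENNReal.ofReal (g i)) :
    ((∫⁻ a, f a ∂tupleMeasure x : ℝ≥0∞) : EReal) = (((∑ i, max (g i) 0) / n : ℝ) : EReal) := by
  have hn' : (0 : ℝ) < n := by exact_mod_cast hn
  have h : ∫⁻ a, f a ∂tupleMeasure x = ENNReal.ofReal ((∑ i, max (g i) 0) / n) := by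
    rw [lintegral_tupleMeasure, ENNReal.ofReal_div_of_pos hn', ENNReal.ofReal_natCast,
      ENNReal.ofReal_sum_of_nonneg fun i _ => le_max_right _ _, ENNReal.div_eq_inv_mul]
    simp [hfg]
  have h0 : 0 ≤ (∑ i, max (g i) 0) / (n : ℝ) :=
    div_nonneg (Finset.sum_nonneg fun i _ => le_max_right _ _) hn'.le
  rw [h, EReal.coe_ennreal_ofReal, max_eq_left h0]

theorem extIntegral_tupleMeasure_coe {n : ℕ} (hn : 0 < n) (x : Fin n → ℝ≥0) {f : ℝ≥0 → EReal}
    {g : Fin n → ℝ} (hfg : ∀ i, f (x i) = g i) :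
    extIntegral (tupleMeasure x) f = (((∑ i, g i) / n : ℝ) : EReal) := by
  rw [extIntegral, lintegral_tupleMeasure_ofReal hn x (g := g) (by simp [hfg]),
    lintegral_tupleMeasure_ofReal hn x (g := fun i => -g i)
      (fun i => by rw [hfg, ← EReal.coe_neg, EReal.real_coe_toENNReal]),
    ← EReal.coe_sub, ← sub_div, ← Finset.sum_sub_distrib]
  refine congrArg (fun t : ℝ => ((t / n : ℝ) : EReal)) (Finset.sum_congr rfl fun i _ => ?_)
  rcases le_total (g i) 0 with h | h
  · rw [max_eq_right h, max_eq_left (by linarith)]; ring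
  · rw [max_eq_left h, max_eq_right (by linarith)]; ring

theorem extIntegral_tupleMeasure_bot {n : ℕ} (x : Fin n → ℝ≥0) {f : ℝ≥0 → EReal} {i : Fin n}
    (hi : f (x i) = ⊥) : extIntegral (tupleMeasure x) f = ⊥ := by
  have h : ∫⁻ a, (-f a).toENNReal ∂tupleMeasure x = ⊤ := by
    rw [lintegral_tupleMeasure, ENNReal.mul_eq_top]
    refine Or.inl ⟨by simp, ?_⟩
    rw [ENNReal.sum_eq_top]
    exact ⟨i, Finset.mem_univ i, by simp [hi]⟩
  rw [extIntegral, h]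
  simp [sub_eq_add_neg]

/-- The entries of a tuple of nonnegative numbers, as a multiset of real numbers. -/
def realEntries {n : ℕ} (x : Fin n → ℝ≥0) : Multiset ℝ := Finset.univ.val.map fun i => (x i : ℝ)

theorem card_realEntries {n : ℕ} (x : Fin n → ℝ≥0) : (realEntries x).card = n := by
  simp [realEntries]

theorem realEntries_nonneg {n : ℕ} (x : Fin n → ℝ≥0) : ∀ a ∈ realEntries x, 0 ≤ a := by
  intro a ha
  obtain ⟨i, _, rfl⟩ := Multiset.mem_map.1 ha
  exact (x i).2

theorem hsProd_realEntries {n : ℕ} (x : Fin n → ℝ≥0) (k : ℕ) (c y : ℝ) :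
    hsProd (realEntries x) k c y = y ^ k * ∏ i, (c * y⁻¹ * (x i : ℝ) + 1 - c) := by
  rw [hsProd, realEntries, Multiset.map_map]
  rfl

/-- The right-hand side is `⊥` when a factor of `hsProd` vanishes, which happens only for `k = n`
and a tuple with a zero entry; the integral on the left is then `⊥` as well. -/
theorem extIntegral_hsKernel {n k : ℕ} (hk : 1 ≤ k) (hkn : k ≤ n) (x : Fin n → ℝ≥0) {y : ℝ}
    (hy : 0 < y) :
    extIntegral (tupleMeasure x) (fun a => hsKernel a y ((k : ℝ) / n)) =
      ENNReal.log (ENNReal.ofReal (hsProd (realEntries x) k ((k : ℝ) / n) y ^ (1 / (k : ℝ)))) := by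
  have hk' : (0 : ℝ) < k := by exact_mod_cast hk
  have hn : 0 < n := hk.trans hkn
  have hn' : (0 : ℝ) < n := by exact_mod_cast hn
  have hc1 : (k : ℝ) / n ≤ 1 := (div_le_one hn').2 (by exact_mod_cast hkn)
  have hc0 : 0 < (k : ℝ) / n := div_pos hk' hn'
  set c := (k : ℝ) / n with hc
  have ht0 : ∀ i, 0 ≤ c * y⁻¹ * (x i : ℝ) + 1 - c := fun i => by
    have : 0 ≤ c * y⁻¹ * (x i : ℝ) := by positivity
    linarith
  rw [hsProd_realEntries]
  by_cases hpos : ∀ i, 0 < c * y⁻¹ * (x i : ℝ) + 1 - c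
  · have hprod := Finset.prod_pos fun i (_ : i ∈ Finset.univ) => hpos i
    rw [extIntegral_tupleMeasure_coe hn x
      (g := fun i => Real.log y + c⁻¹ * Real.log (c * y⁻¹ * (x i : ℝ) + 1 - c)),
      ENNReal.log_ofReal_of_pos (by positivity), Real.log_rpow (by positivity),
      Real.log_mul (by positivity) hprod.ne', Real.log_pow,
      Real.log_prod fun i _ => (hpos i).ne']
    · congr 1
      rw [Finset.sum_add_distrib, ← Finset.mul_sum, hc]
      simp
      field_simp
    · intro i
      rw [hsKernel, if_neg hc0.ne', ENNReal.log_ofReal_of_pos (hpos i), ← EReal.coe_mul,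
        ← EReal.coe_add]
  · push Not at hpos
    obtain ⟨i, hi⟩ := hpos
    have hi' := le_antisymm hi (ht0 i)
    rw [extIntegral_tupleMeasure_bot x (i := i), Finset.prod_eq_zero (Finset.mem_univ i) hi',
      mul_zero, Real.zero_rpow (by positivity), ENNReal.ofReal_zero, ENNReal.log_zero]
    simp only [hsKernel]
    rw [if_neg hc0.ne', hi', ENNReal.ofReal_zero, ENNReal.log_zero,
      EReal.coe_mul_bot_of_pos (inv_pos.2 hc0), EReal.add_bot]

theorem hsMean_le {n k : ℕ} (hk : 1 ≤ k) (hkn : k ≤ n) (x : Fin n → ℝ≥0) {y : ℝ} (hy : 0 < y) :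
    hsMean ((k : ℝ) / n) x ≤
      ENNReal.ofReal (hsProd (realEntries x) k ((k : ℝ) / n) y ^ (1 / (k : ℝ))) := by
  rw [← ENNReal.log_le_log_iff, ← extIntegral_hsKernel hk hkn x hy, hsMean, hsBarycenter,
    EReal.log_exp]
  exact iInf₂_le y hy

theorem hsMean_ne_top {n k : ℕ} (hk : 1 ≤ k) (hkn : k ≤ n) (x : Fin n → ℝ≥0) :
    hsMean ((k : ℝ) / n) x ≠ ∞ :=
  ((hsMean_le hk hkn x one_pos).trans_lt ENNReal.ofReal_lt_top).ne

theorem natCast_div_natCast_le_one {n k : ℕ} (hkn : k ≤ n) : (k : ℝ) / n ≤ 1 :=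
  div_le_one_of_le₀ (by exact_mod_cast hkn) (Nat.cast_nonneg n)

theorem hsMean_toReal_pow_le {n k : ℕ} (hk : 1 ≤ k) (hkn : k ≤ n) (x : Fin n → ℝ≥0) {y : ℝ}
    (hy : 0 < y) :
    (hsMean ((k : ℝ) / n) x).toReal ^ k ≤ hsProd (realEntries x) k ((k : ℝ) / n) y := by
  have h0 := hsProd_nonneg (realEntries_nonneg x) k (by positivity)
    (natCast_div_natCast_le_one hkn) hy
  have h := ENNReal.toReal_le_of_le_ofReal (by positivity) (hsMean_le hk hkn x hy)
  refine (pow_le_pow_left₀ ENNReal.toReal_nonneg h k).trans_eq ?_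
  rw [one_div, Real.rpow_inv_natCast_pow h0 (by lia)]

theorem le_hsMean_toReal {n k : ℕ} (hk : 1 ≤ k) (hkn : k ≤ n) (x : Fin n → ℝ≥0) {b : ℝ}
    (hb0 : 0 ≤ b) (hb : ∀ y, 0 < y → b ^ k ≤ hsProd (realEntries x) k ((k : ℝ) / n) y) :
    b ≤ (hsMean ((k : ℝ) / n) x).toReal := by
  refine (ENNReal.ofReal_le_iff_le_toReal (hsMean_ne_top hk hkn x)).1 ?_
  rw [← ENNReal.log_le_log_iff, hsMean, hsBarycenter, EReal.log_exp]
  refine le_iInf₂ fun y hy => ?_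
  rw [extIntegral_hsKernel hk hkn x hy, ENNReal.log_le_log_iff]
  refine ENNReal.ofReal_le_ofReal ?_
  rw [← Real.pow_rpow_inv_natCast hb0 (show k ≠ 0 by lia), one_div]
  exact Real.rpow_le_rpow (by positivity) (hb y hy) (by positivity)

/-! ### Comparison of the two means -/

theorem coe_symMean {n : ℕ} (k : ℕ) (x : Fin n → ℝ≥0) :
    (symMean k x : ℝ) = avgEsymm (realEntries x) k ^ (1 / (k : ℝ)) := by
  have h : MvPolynomial.eval x (MvPolynomial.esymm (Fin n) ℝ≥0 k) =
      (Finset.univ.val.map x).esymm k := by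
    rw [← MvPolynomial.aeval_esymm_eq_multiset_esymm (Fin n) ℝ≥0, MvPolynomial.aeval_eq_eval]
  have h2 : (((Finset.univ.val.map x).esymm k : ℝ≥0) : ℝ) = (realEntries x).esymm k := by
    rw [realEntries, Finset.esymm_map_val, Finset.esymm_map_val]
    push_cast
    rfl
  rw [symMean, NNReal.coe_rpow, NNReal.coe_div, h, h2, avgEsymm, card_realEntries,
    NNReal.coe_natCast]

theorem coe_symMean_pow {n k : ℕ} (hk : 1 ≤ k) (x : Fin n → ℝ≥0) :
    (symMean k x : ℝ) ^ k = avgEsymm (realEntries x) k := by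
  rw [coe_symMean, one_div,
    Real.rpow_inv_natCast_pow (avgEsymm_nonneg (realEntries_nonneg x) k) (by lia)]

/-- The `k`-th power of the Halász–Székely mean bounds all values of `hsProd` from below, hence the
average of the products of `k` entries. -/
theorem hsMean_le_symMean {n k : ℕ} (hk : 1 ≤ k) (hkn : k ≤ n) (x : Fin n → ℝ≥0) :
    (hsMean ((k : ℝ) / n) x).toReal ≤ symMean k x := by
  refine le_of_pow_le_pow_left₀ (show k ≠ 0 by lia) (NNReal.coe_nonneg _) ?_
  rw [coe_symMean_pow hk]
  exact le_avgEsymm_of_forall_le_hsProd (realEntries_nonneg x) hk (by positivity)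
    (natCast_div_natCast_le_one hkn) fun y hy => hsMean_toReal_pow_le hk hkn x hy

/-- One term of `hsProd` is the average of the products of `k` entries times the largest binomial
probability, which is at least `1 / √(9 k)`. -/
theorem symMean_le_mul_hsMean {n k : ℕ} (hk : 1 ≤ k) (hkn : k ≤ n) (x : Fin n → ℝ≥0) :
    (symMean k x : ℝ) ≤
      (9 * (k : ℝ)) ^ (1 / (2 * (k : ℝ))) * (hsMean ((k : ℝ) / n) x).toReal := by
  have hk' : (0 : ℝ) < k := by exact_mod_cast hk
  set R := (9 * (k : ℝ)) ^ (1 / (2 * (k : ℝ))) with hR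
  have hR0 : 0 < R := by positivity
  have hRk : R ^ k = √(9 * k) := by
    rw [hR, ← Real.rpow_mul_natCast (by positivity), Real.sqrt_eq_rpow]
    congr 1
    field_simp
  rw [← div_le_iff₀' hR0]
  refine le_hsMean_toReal hk hkn x (by positivity) fun y hy => ?_
  have h1 := choose_mul_avgEsymm_le_hsProd (realEntries_nonneg x) (k := k)
    (by rwa [card_realEntries]) (c := (k : ℝ) / n) (by positivity)
    (natCast_div_natCast_le_one hkn) hy
  rw [card_realEntries] at h1
  refine le_trans ?_ h1
  have hs : 0 < √(9 * (k : ℝ)) := by positivity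
  rw [div_pow, hRk, coe_symMean_pow hk, div_le_iff₀ hs]
  have h2 := mul_le_mul_of_nonneg_right (one_le_sqrt_mul_choose_mul hk hkn)
    (avgEsymm_nonneg (realEntries_nonneg x) k)
  linear_combination h2

/-! ### Repeated tuples -/

theorem tupleMeasure_repeat {n m : ℕ} (hm : 1 ≤ m) (x : Fin n → ℝ≥0) :
    tupleMeasure (Fin.repeat m x) = tupleMeasure x := by
  have h : ∑ i, Measure.dirac (Fin.repeat m x i) = (m : ℝ≥0∞) • ∑ i, Measure.dirac (x i) := by
    rw [← finProdFinEquiv.sum_comp, Fintype.sum_prod_type]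
    have : ∀ (a : Fin m) (b : Fin n), Fin.repeat m x (finProdFinEquiv (a, b)) = x b := by
      intro a b
      rw [Fin.repeat_apply]
      congr 1
      exact congrArg Prod.snd (finProdFinEquiv.symm_apply_apply (a, b))
    simp only [this, Finset.sum_const, Finset.card_univ, Fintype.card_fin]
    exact (Nat.cast_smul_eq_nsmul ℝ≥0∞ m _).symm
  have hm0 : (m : ℝ≥0∞) ≠ 0 := by exact_mod_cast (by lia : m ≠ 0)
  rw [tupleMeasure, h, tupleMeasure, smul_smul, Nat.cast_mul,
    ENNReal.mul_inv (Or.inl hm0) (Or.inl (ENNReal.natCast_ne_top m)), mul_right_comm,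
    ENNReal.inv_mul_cancel hm0 (ENNReal.natCast_ne_top m), one_mul]

theorem hsMean_repeat {n k m : ℕ} (hm : 1 ≤ m) (x : Fin n → ℝ≥0) :
    hsMean (((k * m : ℕ) : ℝ) / ((m * n : ℕ) : ℝ)) (Fin.repeat m x) = hsMean ((k : ℝ) / n) x := by
  have hm' : (m : ℝ) ≠ 0 := by exact_mod_cast (by lia : m ≠ 0)
  rw [hsMean, hsMean, tupleMeasure_repeat hm, Nat.cast_mul, Nat.cast_mul, mul_comm (m : ℝ) n,
    mul_div_mul_right _ _ hm']

theorem hsMean_le_symMean_repeat {n k m : ℕ} (hk : 1 ≤ k) (hkn : k ≤ n) (hm : 1 ≤ m)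
    (x : Fin n → ℝ≥0) :
    (hsMean ((k : ℝ) / n) x).toReal ≤ symMean (k * m) (Fin.repeat m x) := by
  rw [← hsMean_repeat hm x]
  exact hsMean_le_symMean (Nat.mul_pos hk hm) (by rw [mul_comm]; gcongr) _

theorem symMean_repeat_le {n k m : ℕ} (hk : 1 ≤ k) (hkn : k ≤ n) (hm : 1 ≤ m)
    (x : Fin n → ℝ≥0) :
    (symMean (k * m) (Fin.repeat m x) : ℝ) ≤
      (9 * (k : ℝ) * m) ^ (1 / (2 * (k : ℝ) * m)) * (hsMean ((k : ℝ) / n) x).toReal := by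
  have h := symMean_le_mul_hsMean (Nat.mul_pos hk hm)
    (show k * m ≤ m * n by rw [mul_comm]; gcongr) (Fin.repeat m x)
  rw [hsMean_repeat hm x] at h
  simpa only [Nat.cast_mul, ← mul_assoc] using h

theorem tendsto_error_factor {k : ℕ} (hk : 1 ≤ k) :
    Tendsto (fun m : ℕ => (9 * (k : ℝ) * m) ^ (1 / (2 * (k : ℝ) * m))) atTop (𝓝 1) := by
  have hk' : (0 : ℝ) < k := by exact_mod_cast hk
  have h1 : Tendsto (fun m : ℕ => 9 * (k : ℝ) * m) atTop atTop :=
    tendsto_natCast_atTop_atTop.const_mul_atTop (by positivity)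
  -- the function is `t ^ (1 / t)` at `t = 9 k m`, raised to the power `9 / 2`
  have h2 := (tendsto_rpow_div.comp h1).rpow_const (p := 9 / 2) (Or.inl one_ne_zero)
  rw [Real.one_rpow] at h2
  refine h2.congr fun m => ?_
  simp only [Function.comp]
  rw [← Real.rpow_mul (by positivity)]
  congr 1
  rcases Nat.eq_zero_or_pos m with rfl | hm
  · simp
  · have : (0 : ℝ) < m := by exact_mod_cast hm
    field_simp

theorem theorem3p1 (n k : ℕ) (hk : 1 ≤ k) (hkn : k ≤ n) :
    -- the HS mean is finite, and it is the limit of the repeated symmetric means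
    (∀ x : Fin n → ℝ≥0, hsMean ((k : ℝ) / n) x ≠ ∞ ∧
      Tendsto (fun m : ℕ => (symMean (k * m) (Fin.repeat m x) : ℝ)) atTop
        (𝓝 (hsMean ((k : ℝ) / n) x).toReal)) ∧
    -- the relative error tends to zero uniformly in the tuple
    (∀ ε : ℝ, 0 < ε → ∃ M : ℕ, ∀ m : ℕ, M ≤ m → ∀ x : Fin n → ℝ≥0,
      |(symMean (k * m) (Fin.repeat m x) : ℝ) - (hsMean ((k : ℝ) / n) x).toReal| ≤
        ε * (hsMean ((k : ℝ) / n) x).toReal) ∧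
    -- the explicit bound
    (∀ m : ℕ, 1 ≤ m → ∀ x : Fin n → ℝ≥0,
      (hsMean ((k : ℝ) / n) x).toReal ≤ (symMean (k * m) (Fin.repeat m x) : ℝ) ∧
      (symMean (k * m) (Fin.repeat m x) : ℝ) ≤
        (9 * (k : ℝ) * m) ^ (1 / (2 * (k : ℝ) * m)) * (hsMean ((k : ℝ) / n) x).toReal) := by
  refine ⟨fun x => ⟨hsMean_ne_top hk hkn x, ?_⟩, fun ε hε => ?_, fun m hm x =>
    ⟨hsMean_le_symMean_repeat hk hkn hm x, symMean_repeat_le hk hkn hm x⟩⟩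
  · have h := (tendsto_error_factor hk).mul_const (hsMean ((k : ℝ) / n) x).toReal
    rw [one_mul] at h
    refine tendsto_of_tendsto_of_tendsto_of_le_of_le' tendsto_const_nhds h ?_ ?_
    · filter_upwards [eventually_ge_atTop 1] with m hm using hsMean_le_symMean_repeat hk hkn hm x
    · filter_upwards [eventually_ge_atTop 1] with m hm using symMean_repeat_le hk hkn hm x
  · have h := (tendsto_error_factor hk).eventually_le_const (lt_add_of_pos_right 1 hε)
    obtain ⟨M, hM⟩ := eventually_atTop.1 (h.and (eventually_ge_atTop 1))
    refine ⟨M, fun m hm x => ?_⟩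
    obtain ⟨h1, h2⟩ := hM m hm
    rw [abs_of_nonneg (sub_nonneg.2 (hsMean_le_symMean_repeat hk hkn h2 x))]
    have h3 := (symMean_repeat_le hk hkn h2 x).trans
      (mul_le_mul_of_nonneg_right h1 ENNReal.toReal_nonneg)
    linarith
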